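/- For linear subspaces $\mathcal X_1,\mathcal X_2$ of a Euclidean space let ${\rm aff}(\mathcal X_1,\mathcal X_2)=\|{\bf U}_1^{\rm T}{\bf U}_2\|_{\rm F}$, where the columns of ${\bf U}_i$ form an orthonormal basis of $\mathcal X_i$ (this does not depend on the choice of the bases; it is the square root of the sum of the squared cosines of the principal angles). A Gaussian random matrix ${\bf\Phi}\in\mathbb R^{n\times N}$ is a random matrix with independent entries of law $\mathcal N(0,1/n)$. Theorem (concentration of affinity between two subspaces). For every $\varepsilon>0$ there exist constants $c_1(\varepsilon),c_2(\varepsilon)>0$, depending only on $\varepsilon$, such that the following holds. Let $\mathcal X_1,\mathcal X_2\subset\mathbb R^N$ be subspaces of dimensions $d_1\le d_2$, let $n<N$ with $n>c_1(\varepsilon)\,d_2$, let ${\bf\Phi}\in\mathbb R^{n\times N}$ be a Gaussian random matrix, and let $\mathcal Y_i=\{{\bf\Phi}{\bf x}:{\bf x}\in\mathcal X_i\}$, $i=1,2$. Write ${\rm aff}_{\mathcal X}={\rm aff}(\mathcal X_1,\mathcal X_2)$, ${\rm aff}_{\mathcal Y}={\rm aff}(\mathcal Y_1,\mathcal Y_2)$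 and $$\overline{\rm aff}_{\mathcal Y}^2={\rm aff}_{\mathcal X}^2+\frac{d_2}{n}\left(d_1-{\rm aff}_{\mathcal X}^2\right).$$ Then, with probability at least $1-{\rm e}^{-c_2(\varepsilon)n}$, $$\left|{\rm aff}_{\mathcal Y}^2-\overline{\rm aff}_{\mathcal Y}^2\right|\le\left(d_1-{\rm aff}_{\mathcal X}^2\right)\varepsilon ,$$ and if $\mathcal X_1\not\subseteq\mathcal X_2$ (equivalently, $d_1-{\rm aff}_{\mathcal X}^2>0$), then also the strict inequality $$\left|{\rm aff}_{\mathcal Y}^2-\overline{\rm aff}_{\mathcal Y}^2\right|<\left(d_1-{\rm aff}_{\mathcal X}^2\right)\varepsilon$$ holds with probability at least $1-{\rm e}^{-c_2(\varepsilon)n}$. -/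

import Mathlib

open MeasureTheory ProbabilityTheory

noncomputable section

/-- The matrix product `U₁ᵀ U₂`, where the columns of `U₁`, `U₂` are the given families of vectors of
`ℝᴺ`: the matrix of their mutual inner products. -/
def crossGram {N : ℕ} {ι κ : Type*} (u : ι → EuclideanSpace ℝ (Fin N))
    (v : κ → EuclideanSpace ℝ (Fin N)) : Matrix ι κ ℝ :=
  Matrix.of fun i j => inner ℝ (u i) (v j)

/-- The Frobenius norm of a real matrix. -/
def frobNorm {ι κ : Type*} [Fintype ι] [Fintype κ] (A : Matrix ι κ ℝ) : ℝ :=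
  Real.sqrt (∑ i, ∑ j, A i j ^ 2)

/-- The affinity `‖U₁ᵀ U₂‖_F` of two subspaces of `ℝᴺ`, computed in one choice of orthonormal bases;
`affinity_eq_frobNorm` shows that every other choice gives the same value. -/
def affinity {N : ℕ} (X₁ X₂ : Submodule ℝ (EuclideanSpace ℝ (Fin N))) : ℝ :=
  frobNorm (crossGram (fun i => (stdOrthonormalBasis ℝ X₁ i : EuclideanSpace ℝ (Fin N)))
    (fun j => (stdOrthonormalBasis ℝ X₂ j : EuclideanSpace ℝ (Fin N))))

theorem sum_inner_sq_eq {N : ℕ} {ι : Type*} [Fintype ι]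
    {X : Submodule ℝ (EuclideanSpace ℝ (Fin N))}
    (b : OrthonormalBasis ι ℝ X) (x : EuclideanSpace ℝ (Fin N)) :
    ∑ i, inner ℝ (b i : EuclideanSpace ℝ (Fin N)) x ^ 2 = ‖X.orthogonalProjectionOnto x‖ ^ 2 := by
  rw [← b.sum_sq_norm_inner_right]
  refine Finset.sum_congr rfl fun i _ => ?_
  rw [Submodule.inner_orthogonalProjectionOnto_eq_of_mem_left, Real.norm_eq_abs, sq_abs]

/-- The affinity is `‖U₁ᵀ U₂‖_F` for arbitrary orthonormal bases of the two subspaces. -/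
theorem affinity_eq_frobNorm {N : ℕ} {ι κ : Type*} [Fintype ι] [Fintype κ]
    {X₁ X₂ : Submodule ℝ (EuclideanSpace ℝ (Fin N))}
    (b₁ : OrthonormalBasis ι ℝ X₁) (b₂ : OrthonormalBasis κ ℝ X₂) :
    affinity X₁ X₂ = frobNorm (crossGram (fun i => (b₁ i : EuclideanSpace ℝ (Fin N)))
      (fun j => (b₂ j : EuclideanSpace ℝ (Fin N)))) := by
  simp only [affinity, frobNorm, crossGram, Matrix.of_apply]
  congr 1
  rw [Finset.sum_comm]
  simp_rw [sum_inner_sq_eq (stdOrthonormalBasis ℝ X₁), ← sum_inner_sq_eq b₁]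
  rw [Finset.sum_comm]
  simp_rw [real_inner_comm _ (b₁ _ : EuclideanSpace ℝ (Fin N)), sum_inner_sq_eq]

/-- The image `{Φ x | x ∈ X}` of a subspace `X` of `ℝᴺ` under a matrix `Φ`. -/
def projectedSubspace {n N : ℕ} (Φ : Matrix (Fin n) (Fin N) ℝ)
    (X : Submodule ℝ (EuclideanSpace ℝ (Fin N))) : Submodule ℝ (EuclideanSpace ℝ (Fin n)) :=
  X.map (Matrix.toEuclideanLin Φ)

/-- A random `n × N` matrix whose entries are independent with law `𝒩(0, 1/n)`. -/
structure IsGaussianRandomMatrix {Ω : Type*} [MeasurableSpace Ω] {n N : ℕ}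
    (Φ : Ω → Matrix (Fin n) (Fin N) ℝ) (P : Measure Ω) : Prop where
  indep : iIndepFun (fun (p : Fin n × Fin N) (ω : Ω) => Φ ω p.1 p.2) P
  law : ∀ i j, HasLaw (fun ω => Φ ω i j) (gaussianReal 0 (1 / (n : NNReal))) P

/-- The estimate `aff_X² + (d₂ / n) (d₁ - aff_X²)` of the squared affinity of the images of
`X₁`, `X₂` in `ℝⁿ`, where `dᵢ = dim Xᵢ`. -/
def affinityEstimateSq {N : ℕ} (n : ℕ) (X₁ X₂ : Submodule ℝ (EuclideanSpace ℝ (Fin N))) : ℝ :=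
  affinity X₁ X₂ ^ 2 + (Module.finrank ℝ X₂ : ℝ) / (n : ℝ)
    * ((Module.finrank ℝ X₁ : ℝ) - affinity X₁ X₂ ^ 2)

end

/-! The quantity `d₁ - aff²` is the sum `D` of squared sines of the principal angles: the squared
Hilbert–Schmidt norm of `1 - P_{X₂}` on `X₁` (`finrank_sub_affinity_sq`). If `Φ` distorts squared
norms on `X₁ + X₂` by factors in `[1 - δ, 1 + δ]`, then `D` changes by a factor between `(1 - δ)/(1
+ δ)` and its inverse (`subspaceGap_map`). The error is thus proportional to `D`, as required. The
correction `(d₂/n) D` of the estimate needs no exact computation: `n > c₁ d₂` makes it a small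
multiple of `D`.

The near-isometry holds with high probability by `χ²` concentration for each vector and a union
bound over a net (`measure_not_nearIsometry_le`); the net is exponential in `d₂`, so large `n / d₂`
absorbs its size. -/

/-! ### Hilbert–Schmidt norms -/

section HilbertSchmidt

variable {V W F : Type*} [NormedAddCommGroup V] [InnerProductSpace ℝ V] [FiniteDimensional ℝ V]
  [NormedAddCommGroup W] [InnerProductSpace ℝ W] [FiniteDimensional ℝ W]
  [NormedAddCommGroup F] [InnerProductSpace ℝ F] [FiniteDimensional ℝ F]

/-- The Hilbert–Schmidt norm of a linear map is that of its adjoint. -/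
theorem sum_norm_sq_eq_sum_norm_sq_adjoint {ι κ : Type*} [Fintype ι] [Fintype κ]
    (A : V →ₗ[ℝ] W) (v : OrthonormalBasis ι ℝ V) (w : OrthonormalBasis κ ℝ W) :
    ∑ i, ‖A (v i)‖ ^ 2 = ∑ k, ‖A.adjoint (w k)‖ ^ 2 := by
  simp_rw [← w.sum_sq_norm_inner_right (A _), ← v.sum_sq_norm_inner_left (A.adjoint _),
    LinearMap.adjoint_inner_left]
  exact Finset.sum_comm

theorem norm_sq_adjoint_le {S : V →ₗ[ℝ] W} {c : ℝ} (hc : 0 ≤ c)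
    (hS : ∀ x, ‖S x‖ ^ 2 ≤ c * ‖x‖ ^ 2) (w : W) : ‖S.adjoint w‖ ^ 2 ≤ c * ‖w‖ ^ 2 := by
  rcases eq_or_ne (S.adjoint w) 0 with h0 | h0
  · simpa [h0] using mul_nonneg hc (sq_nonneg ‖w‖)
  have h1 : ‖S.adjoint w‖ ^ 2 ≤ ‖w‖ * ‖S (S.adjoint w)‖ := by
    rw [← real_inner_self_eq_norm_sq, LinearMap.adjoint_inner_left]
    exact real_inner_le_norm _ _
  have h2 : 0 < ‖S.adjoint w‖ ^ 2 := by positivity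
  have h3 : (‖S.adjoint w‖ ^ 2) ^ 2 ≤ ‖w‖ ^ 2 * (c * ‖S.adjoint w‖ ^ 2) := calc
    _ ≤ (‖w‖ * ‖S (S.adjoint w)‖) ^ 2 := by gcongr
    _ = ‖w‖ ^ 2 * ‖S (S.adjoint w)‖ ^ 2 := mul_pow _ _ _
    _ ≤ _ := by gcongr; exact hS _
  refine le_of_mul_le_mul_right ?_ h2
  linarith

/-- The Hilbert–Schmidt norm of a composition is bounded by the operator norm of the inner map times
the Hilbert–Schmidt norm of the outer one. -/
theorem sum_norm_sq_comp_le {ι κ : Type*} [Fintype ι] [Fintype κ] {S : V →ₗ[ℝ] W}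
    {c : ℝ} (hc : 0 ≤ c) (hS : ∀ x, ‖S x‖ ^ 2 ≤ c * ‖x‖ ^ 2) (A : W →ₗ[ℝ] F)
    (v : OrthonormalBasis ι ℝ V) (w : OrthonormalBasis κ ℝ W) :
    ∑ i, ‖A (S (v i))‖ ^ 2 ≤ c * ∑ k, ‖A (w k)‖ ^ 2 := by
  -- Taking adjoints makes `S` the outer map, so its operator bound applies term by term.
  let f := stdOrthonormalBasis ℝ F
  have h := sum_norm_sq_eq_sum_norm_sq_adjoint (A ∘ₗ S) v f
  simp only [LinearMap.comp_apply] at h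
  rw [h, sum_norm_sq_eq_sum_norm_sq_adjoint A w f, Finset.mul_sum, LinearMap.adjoint_comp]
  exact Finset.sum_le_sum fun k _ => norm_sq_adjoint_le hc hS _

end HilbertSchmidt

/-! ### Squared sines under near-isometries -/

section Gap

variable {E E' : Type*} [NormedAddCommGroup E] [InnerProductSpace ℝ E] [FiniteDimensional ℝ E]
  [NormedAddCommGroup E'] [InnerProductSpace ℝ E'] [FiniteDimensional ℝ E']

theorem norm_sub_starProjection_le (U : Submodule ℝ E) (x : E) {z : E} (hz : z ∈ U) :
    ‖x - U.starProjection x‖ ≤ ‖x - z‖ := by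
  rw [U.starProjection_minimal]
  exact ciInf_le ⟨0, by rintro _ ⟨y, rfl⟩; positivity⟩ (⟨z, hz⟩ : U)

/-- The sum of the squared sines of the principal angles from `X₁` to `X₂`. -/
noncomputable def subspaceGap (X₁ X₂ : Submodule ℝ E) : ℝ :=
  ∑ i, ‖(stdOrthonormalBasis ℝ X₁ i : E) - X₂.starProjection (stdOrthonormalBasis ℝ X₁ i : E)‖ ^ 2

theorem subspaceGap_nonneg (X₁ X₂ : Submodule ℝ E) : 0 ≤ subspaceGap X₁ X₂ :=
  Finset.sum_nonneg fun _ _ => sq_nonneg _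

theorem le_of_subspaceGap_eq_zero {X₁ X₂ : Submodule ℝ E} (h : subspaceGap X₁ X₂ = 0) :
    X₁ ≤ X₂ := by
  rw [subspaceGap, Finset.sum_eq_zero_iff_of_nonneg fun _ _ => sq_nonneg _] at h
  intro x hx
  have hb := (stdOrthonormalBasis ℝ X₁).sum_repr ⟨x, hx⟩
  replace hb : ∑ i, (stdOrthonormalBasis ℝ X₁).repr ⟨x, hx⟩ i • (stdOrthonormalBasis ℝ X₁ i : E)
      = x := by simpa using congrArg Subtype.val hb
  rw [← hb]
  refine Submodule.sum_mem _ fun i _ => Submodule.smul_mem _ _ ?_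
  have := h i (Finset.mem_univ i)
  rw [sq_eq_zero_iff, norm_eq_zero, sub_eq_zero] at this
  rw [this]
  exact Submodule.starProjection_apply_mem _ _

/-- `S` need not carry an orthonormal basis to one, so the sum over `S` of a basis is compared
through the Hilbert–Schmidt norm of `1 - P_{X₂}`. -/
theorem subspaceGap_le_of_linearMap {X₁ X₂ : Submodule ℝ E} {Y₁ Y₂ : Submodule ℝ E'}
    (S : Y₁ →ₗ[ℝ] X₁) {c d : ℝ} (hc : 0 ≤ c) (hd : 0 ≤ d) (hS : ∀ y, ‖S y‖ ^ 2 ≤ c * ‖y‖ ^ 2)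
    (h : ∀ y : Y₁, ‖(y : E') - Y₂.starProjection (y : E')‖ ^ 2
      ≤ d * ‖(S y : E) - X₂.starProjection (S y : E)‖ ^ 2) :
    subspaceGap Y₁ Y₂ ≤ d * c * subspaceGap X₁ X₂ := by
  let A : X₁ →ₗ[ℝ] E := (LinearMap.id - (X₂.starProjection : E →ₗ[ℝ] E)) ∘ₗ X₁.subtype
  have hA : ∀ x, A x = (x : E) - X₂.starProjection (x : E) := fun x => rfl
  have key := sum_norm_sq_comp_le hc hS A (stdOrthonormalBasis ℝ Y₁) (stdOrthonormalBasis ℝ X₁)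
  simp only [hA] at key
  rw [mul_assoc]
  refine le_trans ?_ (mul_le_mul_of_nonneg_left key hd)
  rw [subspaceGap, Finset.mul_sum]
  exact Finset.sum_le_sum fun i _ => h _

/-- Projections minimise distance, so `T` of a nearest point, or a preimage of one, is a competitor
on the other side. The differences involved lie in `X₁ ⊔ X₂`. -/
theorem subspaceGap_map {X₁ X₂ : Submodule ℝ E} {T : E →ₗ[ℝ] E'} {a b : ℝ} (ha : 0 < a)
    (hb : 0 ≤ b) (hlow : ∀ x ∈ X₁ ⊔ X₂, a * ‖x‖ ^ 2 ≤ ‖T x‖ ^ 2)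
    (hupp : ∀ x ∈ X₁ ⊔ X₂, ‖T x‖ ^ 2 ≤ b * ‖x‖ ^ 2) :
    Module.finrank ℝ (X₁.map T) = Module.finrank ℝ X₁ ∧
      subspaceGap (X₁.map T) (X₂.map T) ≤ b * a⁻¹ * subspaceGap X₁ X₂ ∧
      subspaceGap X₁ X₂ ≤ a⁻¹ * b * subspaceGap (X₁.map T) (X₂.map T) := by
  have hinj : Set.InjOn T X₁ := by
    intro x hx y hy hxy
    have := hlow (x - y) (Submodule.mem_sup_left (X₁.sub_mem hx hy))
    rw [map_sub, hxy, sub_self, norm_zero] at this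
    have h0 : ‖x - y‖ ^ 2 ≤ 0 := by
      by_contra! h
      have := mul_pos ha h
      linarith
    have h1 : ‖x - y‖ = 0 := by
      nlinarith [norm_nonneg (x - y)]
    exact sub_eq_zero.1 (norm_eq_zero.1 h1)
  let e : X₁ ≃ₗ[ℝ] X₁.map T := LinearEquiv.ofBijective (T.submoduleMap X₁)
    ⟨fun x y hxy => Subtype.ext (hinj x.2 y.2 (congrArg Subtype.val hxy)),
      T.submoduleMap_surjective X₁⟩
  have he : ∀ x : X₁, (e x : E') = T x := fun x => rfl
  have hes : ∀ y : X₁.map T, T (e.symm y : E) = y := fun y => by rw [← he, e.apply_symm_apply]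
  refine ⟨e.finrank_eq.symm, ?_, ?_⟩
  · refine subspaceGap_le_of_linearMap (e.symm : X₁.map T →ₗ[ℝ] X₁) (by positivity) hb ?_ ?_
    · intro y
      rw [inv_mul_eq_div, le_div_iff₀ ha, mul_comm]
      refine (hlow _ (Submodule.mem_sup_left (e.symm y).2)).trans_eq ?_
      rw [hes]
      rfl
    · intro y
      set x : E := (e.symm y : E) with hx
      have hz := X₂.starProjection_apply_mem x
      calc _ ≤ ‖(y : E') - T (X₂.starProjection x)‖ ^ 2 := by
            gcongr
            exact norm_sub_starProjection_le _ _ (Submodule.mem_map_of_mem hz)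
        _ = ‖T (x - X₂.starProjection x)‖ ^ 2 := by rw [map_sub, hes]
        _ ≤ _ := hupp _ (Submodule.sub_mem _ (Submodule.mem_sup_left (e.symm y).2)
            (Submodule.mem_sup_right hz))
  · refine subspaceGap_le_of_linearMap (e : X₁ →ₗ[ℝ] X₁.map T) hb (by positivity) ?_ ?_
    · exact fun x => hupp _ (Submodule.mem_sup_left x.2)
    · intro x
      obtain ⟨z, hz, hzx⟩ := (X₂.map T).starProjection_apply_mem (T x)
      rw [inv_mul_eq_div, le_div_iff₀ ha, mul_comm]
      calc _ ≤ a * ‖(x : E) - z‖ ^ 2 := by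
            gcongr
            exact norm_sub_starProjection_le _ _ hz
        _ ≤ ‖T (x - z)‖ ^ 2 := hlow _ (Submodule.sub_mem _ (Submodule.mem_sup_left x.2)
            (Submodule.mem_sup_right hz))
        _ = _ := by
            rw [map_sub, hzx]
            rfl

end Gap

theorem finrank_sub_affinity_sq {N : ℕ} (X₁ X₂ : Submodule ℝ (EuclideanSpace ℝ (Fin N))) :
    (Module.finrank ℝ X₁ : ℝ) - affinity X₁ X₂ ^ 2 = subspaceGap X₁ X₂ := by
  have h : affinity X₁ X₂ ^ 2
      = ∑ i, ‖X₂.starProjection (stdOrthonormalBasis ℝ X₁ i : EuclideanSpace ℝ (Fin N))‖ ^ 2 := by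
    rw [affinity, frobNorm, Real.sq_sqrt (by positivity)]
    refine Finset.sum_congr rfl fun i _ => ?_
    simp only [crossGram, Matrix.of_apply]
    simp_rw [real_inner_comm _ (stdOrthonormalBasis ℝ X₁ i : EuclideanSpace ℝ (Fin N))]
    rw [sum_inner_sq_eq]
    rfl
  have hcard : (Module.finrank ℝ X₁ : ℝ) = ∑ _i : Fin (Module.finrank ℝ X₁), (1 : ℝ) := by simp
  rw [h, hcard, ← Finset.sum_sub_distrib, subspaceGap]
  refine Finset.sum_congr rfl fun i _ => ?_
  have h1 := X₂.norm_sq_eq_add_norm_sq_starProjection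
    (stdOrthonormalBasis ℝ X₁ i : EuclideanSpace ℝ (Fin N))
  have h2 : ‖(stdOrthonormalBasis ℝ X₁ i : EuclideanSpace ℝ (Fin N))‖ = 1 :=
    (stdOrthonormalBasis ℝ X₁).orthonormal.1 i
  rw [h2, Submodule.starProjection_orthogonal_val] at h1
  linarith

/-! ### Nets and operator norms -/

section Net

variable {V : Type*} [NormedAddCommGroup V] [InnerProductSpace ℝ V]

theorem exists_finset_card_le_five_pow (V : Type*) [NormedAddCommGroup V] [NormedSpace ℝ V]
    [FiniteDimensional ℝ V] :
    ∃ s : Finset V, s.card ≤ 5 ^ Module.finrank ℝ V ∧ (∀ x ∈ s, ‖x‖ ≤ 1) ∧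
      ∀ u : V, ‖u‖ ≤ 1 → ∃ x ∈ s, ‖u - x‖ ≤ 1 / 2 := by
  classical
  let p : ℕ → Prop := fun m => ∃ s : Finset V, s.card = m ∧ (∀ c ∈ s, ‖c‖ ≤ 2) ∧
    ∀ c ∈ s, ∀ d ∈ s, c ≠ d → 1 ≤ ‖c - d‖
  have hle : ∀ m, p m → m ≤ 5 ^ Module.finrank ℝ V := by
    rintro _ ⟨s, rfl, h1, h2⟩
    exact Besicovitch.card_le_of_separated s h1 h2
  -- A largest 1-separated subset of the ball of radius 2 is a 1-net there; halving it gives the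
  -- net.
  obtain ⟨s, hcard, h1, h2⟩ : p (Nat.findGreatest p (5 ^ Module.finrank ℝ V)) :=
    Nat.findGreatest_spec (m := 0) (Nat.zero_le _) ⟨∅, by simp⟩
  have hmax : ∀ v : V, ‖v‖ ≤ 2 → ∃ c ∈ s, ‖v - c‖ < 1 := by
    intro v hv
    by_contra! hsep
    have hvs : v ∉ s := fun hmem => by
      have := hsep v hmem
      norm_num at this
    have hp : p (s.card + 1) := by
      refine ⟨insert v s, Finset.card_insert_of_notMem hvs, ?_, ?_⟩
      · simpa using ⟨hv, h1⟩
      · intro c hc d hd hcd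
        rw [Finset.mem_insert] at hc hd
        rcases hc with rfl | hc <;> rcases hd with rfl | hd
        · exact absurd rfl hcd
        · exact hsep d hd
        · rw [norm_sub_rev]
          exact hsep c hc
        · exact h2 c hc d hd hcd
    have := Nat.le_findGreatest (hle _ hp) hp
    omega
  have hhalf : ∀ c : V, ‖(2⁻¹ : ℝ) • c‖ = ‖c‖ / 2 := fun c => by
    rw [norm_smul]
    norm_num
    ring
  refine ⟨s.image fun c => (2⁻¹ : ℝ) • c, ?_, ?_, ?_⟩
  · exact Finset.card_image_le.trans (Besicovitch.card_le_of_separated s h1 h2)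
  · intro x hx
    obtain ⟨c, hc, rfl⟩ := Finset.mem_image.1 hx
    rw [hhalf]
    linarith [h1 c hc]
  · intro u hu
    obtain ⟨c, hc, hcu⟩ := hmax ((2 : ℝ) • u) (by rw [norm_smul]; norm_num; linarith)
    refine ⟨_, Finset.mem_image_of_mem _ hc, ?_⟩
    have : u - (2⁻¹ : ℝ) • c = (2⁻¹ : ℝ) • ((2 : ℝ) • u - c) := by
      rw [smul_sub, smul_smul]
      norm_num
    rw [this, hhalf]
    linarith

/-- The norm of an operator is controlled by its matrix coefficients on a `1/2`-net of the unit
ball. -/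
theorem norm_le_of_inner_le_on_net (A : V →L[ℝ] V) {s : Finset V} {η : ℝ} (hη : 0 ≤ η)
    (hs : ∀ u : V, ‖u‖ ≤ 1 → ∃ x ∈ s, ‖u - x‖ ≤ 1 / 2)
    (hA : ∀ x ∈ s, ∀ y ∈ s, inner ℝ x (A y) ≤ η) : ‖A‖ ≤ 4 * η := by
  have h1 : ∀ y ∈ s, ‖A y‖ ≤ 2 * η := by
    intro y hy
    rcases eq_or_ne (A y) 0 with h0 | h0
    · rw [h0, norm_zero]
      positivity
    have hpos : 0 < ‖A y‖ := norm_pos_iff.2 h0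
    -- Approximating the direction of `A y` gives `‖A y‖ ≤ η + ‖A y‖ / 2`; the same absorption is
    -- then used in the other argument.
    obtain ⟨x, hx, hux⟩ := hs (‖A y‖⁻¹ • A y) (by
      rw [norm_smul, norm_inv, norm_norm, inv_mul_cancel₀ hpos.ne'])
    have h2 : inner ℝ (‖A y‖⁻¹ • A y) (A y) = ‖A y‖ := by
      rw [real_inner_smul_left, real_inner_self_eq_norm_sq]
      field_simp
    have h3 := real_inner_le_norm (‖A y‖⁻¹ • A y - x) (A y)
    rw [inner_sub_left, h2] at h3
    nlinarith [hA x hx y hy]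
  have h2 : ‖A‖ ≤ 2 * η + 1 / 2 * ‖A‖ := by
    refine ContinuousLinearMap.opNorm_le_of_unit_norm (by positivity) fun u hu => ?_
    obtain ⟨y, hy, huy⟩ := hs u hu.le
    calc ‖A u‖ = ‖A y + A (u - y)‖ := by rw [map_sub]; congr 1; abel
      _ ≤ ‖A y‖ + ‖A (u - y)‖ := norm_add_le _ _
      _ ≤ 2 * η + ‖A‖ * (1 / 2) := by
        gcongr
        · exact h1 y hy
        · exact (A.le_opNorm _).trans (by gcongr)
      _ = _ := by ring
  linarith

/-- A linear map that nearly preserves the norms of sums and differences of points of a `1/2`-net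
nearly preserves all norms. -/
theorem abs_norm_sq_sub_le_of_net [FiniteDimensional ℝ V] {F : Type*} [NormedAddCommGroup F]
    [InnerProductSpace ℝ F] [FiniteDimensional ℝ F] (T : V →ₗ[ℝ] F) {s : Finset V} {η : ℝ}
    (hη : 0 ≤ η)
    (hs1 : ∀ x ∈ s, ‖x‖ ≤ 1)
    (hs : ∀ u : V, ‖u‖ ≤ 1 → ∃ x ∈ s, ‖u - x‖ ≤ 1 / 2)
    (hadd : ∀ x ∈ s, ∀ y ∈ s, |‖T (x + y)‖ ^ 2 - ‖x + y‖ ^ 2| ≤ η * ‖x + y‖ ^ 2)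
    (hsub : ∀ x ∈ s, ∀ y ∈ s, |‖T (x - y)‖ ^ 2 - ‖x - y‖ ^ 2| ≤ η * ‖x - y‖ ^ 2) (x : V) :
    |‖T x‖ ^ 2 - ‖x‖ ^ 2| ≤ 4 * η * ‖x‖ ^ 2 := by
  let A : V →L[ℝ] V := LinearMap.toContinuousLinearMap (T.adjoint ∘ₗ T - LinearMap.id)
  have hA : ∀ x y, inner ℝ x (A y) = inner ℝ (T x) (T y) - inner ℝ x y := by
    intro x y
    simp [A, inner_sub_right, LinearMap.adjoint_inner_right]
  have hnorm : ‖A‖ ≤ 4 * η := by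
    refine norm_le_of_inner_le_on_net A hη hs fun x hx y hy => ?_
    -- Polarization: `4⟪x, A y⟫ ≤ η (‖x + y‖² + ‖x - y‖²) ≤ 4η`.
    have h1 := (abs_le.1 (hadd x hx y hy)).2
    have h2 := (abs_le.1 (hsub x hx y hy)).1
    have h3 : ‖x‖ ^ 2 ≤ 1 := pow_le_one₀ (norm_nonneg _) (hs1 x hx)
    have h4 : ‖y‖ ^ 2 ≤ 1 := pow_le_one₀ (norm_nonneg _) (hs1 y hy)
    rw [hA]
    simp only [map_add, map_sub, norm_add_sq_real, norm_sub_sq_real] at h1 h2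
    nlinarith
  have hx : ‖T x‖ ^ 2 - ‖x‖ ^ 2 = inner ℝ x (A x) := by
    rw [hA, real_inner_self_eq_norm_sq, real_inner_self_eq_norm_sq]
  rw [hx]
  calc |inner ℝ x (A x)| ≤ ‖x‖ * ‖A x‖ := abs_real_inner_le_norm _ _
    _ ≤ ‖x‖ * (4 * η * ‖x‖) := by
      gcongr
      exact (A.le_opNorm x).trans (by gcongr)
    _ = _ := by ring

end Net

/-! ### Concentration of `χ²` -/

theorem one_le_one_sub_mul_exp {t : ℝ} (h2 : t ≤ 1 / 4) :
    1 ≤ (1 - 2 * t) * Real.exp (2 * t + 4 * t ^ 2) := by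
  rcases le_total t 0 with ht | ht
  -- Here `(1 - 2t)(1 + 2t + 4t²) = 1 - 8t³ ≥ 1`; for `t ≥ 0` the quadratic term of `exp` is needed.
  · have h := Real.add_one_le_exp (2 * t + 4 * t ^ 2)
    have h3 : 0 ≤ (-t) ^ 3 := by apply pow_nonneg; linarith
    calc (1 : ℝ) ≤ (1 - 2 * t) * (2 * t + 4 * t ^ 2 + 1) := by nlinarith
      _ ≤ _ := by gcongr; linarith
  · have h := Real.quadratic_le_exp_of_nonneg (x := 2 * t + 4 * t ^ 2) (by positivity)
    calc (1 : ℝ) ≤ (1 - 2 * t) * (1 + (2 * t + 4 * t ^ 2) + (2 * t + 4 * t ^ 2) ^ 2 / 2) := by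
          have : 0 ≤ t ^ 2 * ((1 / 4 - t)) := by
            apply mul_nonneg (sq_nonneg t); linarith
          have : 0 ≤ t ^ 3 * ((1 / 4 - t)) := by
            apply mul_nonneg (by positivity); linarith
          have : 0 ≤ t ^ 4 * ((1 / 4 - t)) := by
            apply mul_nonneg (by positivity); linarith
          nlinarith [sq_nonneg t, pow_nonneg ht 3, pow_nonneg ht 4]
      _ ≤ _ := by gcongr; linarith

theorem inv_sqrt_one_sub_le_exp {t : ℝ} (h2 : t ≤ 1 / 4) :
    (Real.sqrt (1 - 2 * t))⁻¹ ≤ Real.exp (t + 2 * t ^ 2) := by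
  have h : 0 < 1 - 2 * t := by linarith
  rw [inv_le_iff_one_le_mul₀ (Real.sqrt_pos.2 h)]
  have h3 := Real.sqrt_le_sqrt (one_le_one_sub_mul_exp h2)
  rw [Real.sqrt_one, Real.sqrt_mul h.le, show 2 * t + 4 * t ^ 2 = (t + 2 * t ^ 2) + (t + 2 * t ^ 2)
    by ring, Real.exp_add, Real.sqrt_mul_self (Real.exp_pos _).le] at h3
  linarith

section SquaredGaussian

variable {v : NNReal}

theorem gaussianPDFReal_mul_exp_sq (t x : ℝ) (hv : v ≠ 0) :
    gaussianPDFReal 0 v x • Real.exp (t / v * x ^ 2)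
      = (Real.sqrt (2 * Real.pi * v))⁻¹ * Real.exp (-((1 - 2 * t) / (2 * v)) * x ^ 2) := by
  have : (v : ℝ) ≠ 0 := by exact_mod_cast hv
  rw [gaussianPDFReal, smul_eq_mul, mul_assoc, ← Real.exp_add]
  congr 2
  field_simp
  ring

theorem integral_exp_sq_gaussianReal (hv : v ≠ 0) {t : ℝ} (ht : t < 1 / 2) :
    ∫ x, Real.exp (t / v * x ^ 2) ∂gaussianReal 0 v = (Real.sqrt (1 - 2 * t))⁻¹ := by
  have hv' : (0 : ℝ) < v := by positivity
  rw [integral_gaussianReal_eq_integral_smul hv]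
  simp only [gaussianPDFReal_mul_exp_sq _ _ hv]
  rw [integral_const_mul, integral_gaussian, ← Real.sqrt_inv, ← Real.sqrt_inv,
    ← Real.sqrt_mul (by positivity)]
  congr 1
  have : 1 - 2 * t ≠ 0 := by linarith
  field_simp

variable {Ω : Type*} [MeasurableSpace Ω] {P : Measure Ω} {n : ℕ} {Y : Fin n → Ω → ℝ}

theorem integrable_exp_sum_sq (hv : v ≠ 0) (hY : ∀ i, HasLaw (Y i) (gaussianReal 0 v) P)
    (hind : iIndepFun Y P) {t : ℝ} (ht : t < 1 / 2) :
    Integrable (fun ω => Real.exp (t * ∑ i, Y i ω ^ 2 / v)) P ∧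
    mgf (fun ω => ∑ i, Y i ω ^ 2 / v) P t = (Real.sqrt (1 - 2 * t))⁻¹ ^ n := by
  have := hind.isProbabilityMeasure
  have h1 : iIndepFun (fun i ω => Y i ω ^ 2 / v) P :=
    hind.comp (fun _ x => x ^ 2 / (v : ℝ)) fun _ => by fun_prop
  have hm : ∀ i, AEMeasurable (fun ω => Y i ω ^ 2 / v) P := fun i =>
    ((hY i).aemeasurable.pow_const 2).div_const _
  have h2 : ∀ i, mgf (fun ω => Y i ω ^ 2 / v) P t = (Real.sqrt (1 - 2 * t))⁻¹ := by
    intro i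
    rw [← integral_exp_sq_gaussianReal hv ht, ← (hY i).map_eq, integral_map (hY i).aemeasurable
      (by fun_prop), mgf]
    congr 1 with ω
    ring_nf
  have h3 := h1.mgf_sum₀ hm Finset.univ (t := t)
  have h4 : (∑ i, fun ω => Y i ω ^ 2 / (v : ℝ)) = fun ω => ∑ i, Y i ω ^ 2 / (v : ℝ) := by
    ext ω
    simp
  rw [h4] at h3
  simp only [h2, Finset.prod_const, Finset.card_univ, Fintype.card_fin] at h3
  refine ⟨?_, h3⟩
  have h5 : 0 < Real.sqrt (1 - 2 * t) := Real.sqrt_pos.2 (by linarith)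
  -- A non-integrable function has integral `0` by convention, but the computed value is positive.
  by_contra hni
  rw [mgf, integral_undef hni] at h3
  have : 0 < (Real.sqrt (1 - 2 * t))⁻¹ ^ n := by positivity
  exact this.ne h3

/-- Concentration of a `χ²` variable around its mean. -/
theorem measure_abs_sum_sq_sub_ge_le (hv : v ≠ 0) (hY : ∀ i, HasLaw (Y i) (gaussianReal 0 v) P)
    (hind : iIndepFun Y P) {η : ℝ} (h0 : 0 ≤ η) (h1 : η ≤ 1) :
    P.real {ω | η * (n * v) ≤ |∑ i, Y i ω ^ 2 - n * v|} ≤ 2 * Real.exp (-(η ^ 2 / 8 * n)) := by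
  have := hind.isProbabilityMeasure
  have hv' : (0 : ℝ) < v := by positivity
  have key : ∀ t : ℝ, t ≤ 1 / 4 → ∀ ρ : ℝ,
      Real.exp (-t * (n * ρ)) * mgf (fun ω => ∑ i, Y i ω ^ 2 / v) P t
        ≤ Real.exp ((-t * ρ + t + 2 * t ^ 2) * n) := by
    intro t ht2 ρ
    rw [(integrable_exp_sum_sq hv hY hind (by linarith)).2]
    calc _ ≤ Real.exp (-t * (n * ρ)) * Real.exp (t + 2 * t ^ 2) ^ n := by
          gcongr
          exact inv_sqrt_one_sub_le_exp ht2
      _ = _ := by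
          rw [← Real.exp_nat_mul, ← Real.exp_add]
          ring_nf
  -- The choice `t = ±η/4` minimises the exponent `-|t|η + 2t²`, with value `-η²/8`.
  have hup := (measure_ge_le_exp_mul_mgf (n * (1 + η)) (t := η / 4) (by positivity)
    (integrable_exp_sum_sq hv hY hind (by linarith)).1).trans
    (key (η / 4) (by linarith) _)
  have hlo := (measure_le_le_exp_mul_mgf (n * (1 - η)) (t := -(η / 4)) (by linarith)
    (integrable_exp_sum_sq hv hY hind (by linarith)).1).trans
    (key (-(η / 4)) (by linarith) _)
  have hsub : {ω | η * (n * v) ≤ |∑ i, Y i ω ^ 2 - n * v|} ⊆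
      {ω | n * (1 + η) ≤ ∑ i, Y i ω ^ 2 / (v : ℝ)} ∪
      {ω | ∑ i, Y i ω ^ 2 / (v : ℝ) ≤ n * (1 - η)} := by
    intro ω hω
    simp only [Set.mem_ofPred_eq, Set.mem_union, ← Finset.sum_div] at hω ⊢
    rw [le_div_iff₀ hv', div_le_iff₀ hv']
    rcases le_abs.1 hω with h | h
    · left; linarith
    · right; linarith
  calc _ ≤ _ := measureReal_mono hsub
    _ ≤ _ := measureReal_union_le _ _
    _ ≤ Real.exp (-(η ^ 2 / 8 * n)) + Real.exp (-(η ^ 2 / 8 * n)) := by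
      refine add_le_add (hup.trans_eq ?_) (hlo.trans_eq ?_) <;> ring_nf
    _ = _ := by ring

end SquaredGaussian

/-! ### Gaussian matrices acting on a vector -/

section GaussianMatrix

variable {Ω : Type*} [MeasurableSpace Ω] {P : Measure Ω} {n N : ℕ}
  {Φ : Ω → Matrix (Fin n) (Fin N) ℝ}

theorem IsGaussianRandomMatrix.memLp_entry (hΦ : IsGaussianRandomMatrix Φ P) (i : Fin n)
    (j : Fin N) : MemLp (fun ω => Φ ω i j) 2 P :=
  (hΦ.law i j).hasGaussianLaw.memLp_two

theorem IsGaussianRandomMatrix.covariance_entry [IsProbabilityMeasure P]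
    (hΦ : IsGaussianRandomMatrix Φ P) (p q : Fin n × Fin N) :
    covariance (fun ω => Φ ω p.1 p.2) (fun ω => Φ ω q.1 q.2) P
      = if p = q then 1 / (n : ℝ) else 0 := by
  split_ifs with h
  · subst h
    rw [covariance_self (hΦ.law p.1 p.2).aemeasurable, (hΦ.law p.1 p.2).variance_eq,
      variance_id_gaussianReal]
    simp
  · exact (hΦ.indep.indepFun h).covariance_eq_zero (hΦ.memLp_entry _ _) (hΦ.memLp_entry _ _)

theorem IsGaussianRandomMatrix.hasGaussianLaw_mulVec [IsProbabilityMeasure P]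
    (hΦ : IsGaussianRandomMatrix Φ P) (x : Fin N → ℝ) :
    HasGaussianLaw (fun ω i => ∑ j, Φ ω i j * x j) P := by
  have h := hΦ.indep.hasGaussianLaw fun p : Fin n × Fin N => (hΦ.law p.1 p.2).hasGaussianLaw
  let L : (Fin n × Fin N → ℝ) →L[ℝ] (Fin n → ℝ) := LinearMap.toContinuousLinearMap
    { toFun := fun f i => ∑ j, f (i, j) * x j
      map_add' := fun f g => by ext i; simp [add_mul, Finset.sum_add_distrib]
      map_smul' := fun c f => by ext i; simp [mul_assoc, Finset.mul_sum] }
  exact h.map L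

theorem IsGaussianRandomMatrix.covariance_mulVec [IsProbabilityMeasure P]
    (hΦ : IsGaussianRandomMatrix Φ P) (x : Fin N → ℝ) (i k : Fin n) :
    covariance (fun ω => ∑ j, Φ ω i j * x j) (fun ω => ∑ j, Φ ω k j * x j) P
      = if i = k then (∑ j, x j ^ 2) / n else 0 := by
  rw [covariance_fun_sum_fun_sum (fun j => (hΦ.memLp_entry i j).mul_const _)
    fun j => (hΦ.memLp_entry k j).mul_const _]
  simp_rw [covariance_mul_const_left, covariance_mul_const_right,
    fun j l => hΦ.covariance_entry (i, j) (k, l), Prod.mk.injEq]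
  split_ifs with h
  · simp [h, Finset.sum_div]
    exact Finset.sum_congr rfl fun j _ => by ring
  · simp [h]

/-- The coordinates are jointly Gaussian, so being uncorrelated suffices. -/
theorem IsGaussianRandomMatrix.iIndepFun_mulVec [IsProbabilityMeasure P]
    (hΦ : IsGaussianRandomMatrix Φ P) (x : Fin N → ℝ) :
    iIndepFun (fun i ω => ∑ j, Φ ω i j * x j) P :=
  (hΦ.hasGaussianLaw_mulVec x).iIndepFun_of_covariance_eq_zero fun i k hik => by
    rw [hΦ.covariance_mulVec, if_neg hik]

theorem IsGaussianRandomMatrix.hasLaw_mulVec [IsProbabilityMeasure P]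
    (hΦ : IsGaussianRandomMatrix Φ P) (x : Fin N → ℝ) (i : Fin n) :
    HasLaw (fun ω => ∑ j, Φ ω i j * x j) (gaussianReal 0 ((∑ j, x j ^ 2) / n).toNNReal) P := by
  have h : HasGaussianLaw (fun ω => ∑ j, Φ ω i j * x j) P := (hΦ.hasGaussianLaw_mulVec x).eval i
  refine ⟨h.aemeasurable, ?_⟩
  rw [h.map_eq_gaussianReal]
  congr 1
  · rw [integral_finsetSum _ fun j _ => ((hΦ.memLp_entry i j).integrable one_le_two).mul_const _]
    refine Finset.sum_eq_zero fun j _ => ?_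
    rw [integral_mul_const, (hΦ.law i j).integral_eq, integral_id_gaussianReal, zero_mul]
  · rw [← covariance_self h.aemeasurable, hΦ.covariance_mulVec, if_pos rfl]

theorem IsGaussianRandomMatrix.measure_abs_norm_sq_sub_ge_le [IsProbabilityMeasure P]
    (hΦ : IsGaussianRandomMatrix Φ P) (hn : 0 < n) {x : EuclideanSpace ℝ (Fin N)} (hx : x ≠ 0)
    {η : ℝ} (h0 : 0 ≤ η) (h1 : η ≤ 1) :
    P.real {ω | η * ‖x‖ ^ 2 ≤ |‖Matrix.toEuclideanLin (Φ ω) x‖ ^ 2 - ‖x‖ ^ 2|}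
      ≤ 2 * Real.exp (-(η ^ 2 / 8 * n)) := by
  have hx2 : 0 < ‖x‖ ^ 2 := by positivity
  have hn' : (0 : ℝ) < n := by exact_mod_cast hn
  have hsum : ∑ j, x j ^ 2 = ‖x‖ ^ 2 := (EuclideanSpace.real_norm_sq_eq x).symm
  have hv : (((∑ j, x j ^ 2) / n).toNNReal : ℝ) = ‖x‖ ^ 2 / n := by
    rw [hsum, Real.coe_toNNReal _ (by positivity)]
  have hv0 : ((∑ j, x j ^ 2) / n).toNNReal ≠ 0 := by
    rw [← NNReal.coe_ne_zero, hv]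
    positivity
  have h := measure_abs_sum_sq_sub_ge_le hv0 (hΦ.hasLaw_mulVec x) (hΦ.iIndepFun_mulVec x) h0 h1
  rw [hv, mul_div_cancel₀ _ hn'.ne'] at h
  convert! h using 6 with ω
  rw [EuclideanSpace.real_norm_sq_eq]
  rfl

end GaussianMatrix

/-! ### Near-isometry on a subspace -/

section Embedding

variable {Ω : Type*} [MeasurableSpace Ω] {P : Measure Ω} {n N : ℕ}
  {Φ : Ω → Matrix (Fin n) (Fin N) ℝ}

/-- A Gaussian random matrix is a near-isometry on a fixed subspace, with overwhelming
probability. -/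
theorem IsGaussianRandomMatrix.measure_not_nearIsometry_le [IsProbabilityMeasure P]
    (hΦ : IsGaussianRandomMatrix Φ P) (hn : 0 < n)
    (V : Submodule ℝ (EuclideanSpace ℝ (Fin N))) {η : ℝ} (h0 : 0 ≤ η) (h1 : η ≤ 1) :
    P.real {ω | ¬ ∀ x ∈ V, |‖Matrix.toEuclideanLin (Φ ω) x‖ ^ 2 - ‖x‖ ^ 2| ≤ 4 * η * ‖x‖ ^ 2}
      ≤ 4 * 25 ^ Module.finrank ℝ V * Real.exp (-(η ^ 2 / 8 * n)) := by
  classical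
  obtain ⟨s, hcard, hs1, hs⟩ := exists_finset_card_le_five_pow V
  -- Zero is dropped: the bound is trivial there, and the tail estimate needs positive variance.
  let Z : Finset V := (Finset.image₂ (· + ·) s s ∪ Finset.image₂ (· - ·) s s).filter (· ≠ 0)
  have hZ : (Z.card : ℝ) ≤ 2 * 25 ^ Module.finrank ℝ V := by
    have h : Z.card ≤ s.card * s.card + s.card * s.card :=
      (Finset.card_filter_le _ _).trans <| (Finset.card_union_le _ _).trans <|
        add_le_add (Finset.card_image₂_le _ _ _) (Finset.card_image₂_le _ _ _)
    have h2 : s.card * s.card ≤ 25 ^ Module.finrank ℝ V := by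
      rw [show 25 = 5 * 5 by norm_num, mul_pow]
      exact Nat.mul_le_mul hcard hcard
    have h3 : Z.card ≤ 2 * 25 ^ Module.finrank ℝ V := by omega
    exact_mod_cast h3
  have hsub : {ω | ¬ ∀ x ∈ V,
        |‖Matrix.toEuclideanLin (Φ ω) x‖ ^ 2 - ‖x‖ ^ 2| ≤ 4 * η * ‖x‖ ^ 2} ⊆
      ⋃ z ∈ Z, {ω | η * ‖(z : EuclideanSpace ℝ (Fin N))‖ ^ 2
        ≤ |‖Matrix.toEuclideanLin (Φ ω) (z : EuclideanSpace ℝ (Fin N))‖ ^ 2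
          - ‖(z : EuclideanSpace ℝ (Fin N))‖ ^ 2|} := by
    intro ω hω
    by_contra hcon
    simp only [Set.mem_iUnion, Set.mem_ofPred_eq, not_exists, not_le] at hcon
    have hall : ∀ z ∈ Finset.image₂ (· + ·) s s ∪ Finset.image₂ (· - ·) s s,
        |‖(Matrix.toEuclideanLin (Φ ω) ∘ₗ V.subtype) z‖ ^ 2 - ‖z‖ ^ 2| ≤ η * ‖z‖ ^ 2 := by
      intro z hz
      rcases eq_or_ne z 0 with rfl | hz0
      · simp
      · exact (hcon z (Finset.mem_filter.2 ⟨hz, hz0⟩)).le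
    refine hω fun x hx => abs_norm_sq_sub_le_of_net
      (Matrix.toEuclideanLin (Φ ω) ∘ₗ V.subtype) h0 hs1 hs ?_ ?_ ⟨x, hx⟩
    · exact fun a ha b hb =>
        hall _ (Finset.mem_union_left _ (Finset.mem_image₂_of_mem (f := (· + ·)) ha hb))
    · exact fun a ha b hb =>
        hall _ (Finset.mem_union_right _ (Finset.mem_image₂_of_mem (f := (· - ·)) ha hb))
  calc _ ≤ _ := measureReal_mono hsub (measure_ne_top _ _)
    _ ≤ _ := measureReal_biUnion_finset_le _ _
    _ ≤ ∑ _z ∈ Z, 2 * Real.exp (-(η ^ 2 / 8 * n)) := by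
      refine Finset.sum_le_sum fun z hz => hΦ.measure_abs_norm_sq_sub_ge_le hn ?_ h0 h1
      exact fun h => (Finset.mem_filter.1 hz).2 (Subtype.ext h)
    _ = Z.card * (2 * Real.exp (-(η ^ 2 / 8 * n))) := by rw [Finset.sum_const, nsmul_eq_mul]
    _ ≤ 2 * 25 ^ Module.finrank ℝ V * (2 * Real.exp (-(η ^ 2 / 8 * n))) := by gcongr
    _ = _ := by ring

theorem IsGaussianRandomMatrix.measure_not_nearIsometry_sup_le [IsProbabilityMeasure P]
    (hΦ : IsGaussianRandomMatrix Φ P) (hn : 0 < n)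
    {X₁ X₂ : Submodule ℝ (EuclideanSpace ℝ (Fin N))}
    (hd : Module.finrank ℝ X₁ ≤ Module.finrank ℝ X₂) {η : ℝ} (h0 : 0 < η) (h1 : η ≤ 1)
    (hdim : 16 / (η ^ 2 / 8) * Module.finrank ℝ X₂ ≤ n) :
    P.real {ω | ¬ ∀ x ∈ X₁ ⊔ X₂,
        |‖Matrix.toEuclideanLin (Φ ω) x‖ ^ 2 - ‖x‖ ^ 2| ≤ 4 * η * ‖x‖ ^ 2}
      ≤ Real.exp (-(η ^ 2 / 16 * n)) := by
  -- When `d₂ > 0` the prefactor is at most `(4 · 25²)^d₂ ≤ e^(8 d₂)`, and `hdim` lets half of the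
  -- exponent pay for it. When `d₂ = 0` the factor `4` cannot be absorbed, but the bad event is
  -- empty.
  rcases Nat.eq_zero_or_pos (Module.finrank ℝ X₂) with hz | hpos
  · have h2 : X₂ = ⊥ := Submodule.finrank_eq_zero.1 hz
    have h1 : X₁ = ⊥ := Submodule.finrank_eq_zero.1 (by omega)
    have : {ω | ¬ ∀ x ∈ X₁ ⊔ X₂,
        |‖Matrix.toEuclideanLin (Φ ω) x‖ ^ 2 - ‖x‖ ^ 2| ≤ 4 * η * ‖x‖ ^ 2} = ∅ := by
      ext ω
      simp [h1, h2]
    rw [this, measureReal_empty]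
    positivity
  have hV : Module.finrank ℝ ↥(X₁ ⊔ X₂) ≤ 2 * Module.finrank ℝ X₂ :=
    (Submodule.finrank_add_le_finrank_add_finrank X₁ X₂).trans (by omega)
  have hexp8 : (4 * 25 ^ 2 : ℝ) ≤ Real.exp 8 := by
    have h := Real.exp_one_gt_d9
    have h8 : Real.exp 8 = Real.exp 1 ^ 8 := by rw [← Real.exp_nat_mul]; norm_num
    rw [h8]
    calc (4 * 25 ^ 2 : ℝ) ≤ 2.7 ^ 8 := by norm_num
      _ ≤ _ := by gcongr; linarith
  have hcount : (4 * 25 ^ Module.finrank ℝ ↥(X₁ ⊔ X₂) : ℝ)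
      ≤ Real.exp (8 * Module.finrank ℝ X₂) := by
    calc (4 * 25 ^ Module.finrank ℝ ↥(X₁ ⊔ X₂) : ℝ)
        ≤ 4 ^ Module.finrank ℝ X₂ * 25 ^ (2 * Module.finrank ℝ X₂) := by
          gcongr
          · exact le_self_pow₀ (by norm_num) hpos.ne'
          · norm_num
      _ = (4 * 25 ^ 2) ^ Module.finrank ℝ X₂ := by rw [pow_mul, mul_pow]
      _ ≤ Real.exp 8 ^ Module.finrank ℝ X₂ := by gcongr
      _ = _ := by rw [← Real.exp_nat_mul, mul_comm]
  calc _ ≤ _ := hΦ.measure_not_nearIsometry_le hn (X₁ ⊔ X₂) h0.le h1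
    _ ≤ Real.exp (8 * Module.finrank ℝ X₂) * Real.exp (-(η ^ 2 / 8 * n)) := by gcongr
    _ = Real.exp (8 * Module.finrank ℝ X₂ + -(η ^ 2 / 8 * n)) := (Real.exp_add _ _).symm
    _ ≤ _ := by
      rw [Real.exp_le_exp]
      rw [div_mul_eq_mul_div, div_le_iff₀ (by positivity)] at hdim
      linarith

end Embedding

/-! ### The affinity estimate -/

theorem abs_affinity_sq_sub_estimate_le {n N : ℕ} {M : Matrix (Fin n) (Fin N) ℝ}
    {X₁ X₂ : Submodule ℝ (EuclideanSpace ℝ (Fin N))} {δ ρ : ℝ} (h0 : 0 ≤ δ) (h1 : δ ≤ 1 / 2)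
    (hρ : (Module.finrank ℝ X₂ : ℝ) / n ≤ ρ)
    (hM : ∀ x ∈ X₁ ⊔ X₂, |‖Matrix.toEuclideanLin M x‖ ^ 2 - ‖x‖ ^ 2| ≤ δ * ‖x‖ ^ 2) :
    |affinity (projectedSubspace M X₁) (projectedSubspace M X₂) ^ 2 - affinityEstimateSq n X₁ X₂|
      ≤ ((Module.finrank ℝ X₁ : ℝ) - affinity X₁ X₂ ^ 2) * (4 * δ + ρ) := by
  obtain ⟨hdim, hle, hge⟩ := subspaceGap_map (X₁ := X₁) (X₂ := X₂) (T := Matrix.toEuclideanLin M)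
    (a := 1 - δ) (b := 1 + δ) (by linarith) (by linarith)
    (fun x hx => by linarith [(abs_le.1 (hM x hx)).1])
    (fun x hx => by linarith [(abs_le.1 (hM x hx)).2])
  have hY := finrank_sub_affinity_sq (projectedSubspace M X₁) (projectedSubspace M X₂)
  have hX := finrank_sub_affinity_sq X₁ X₂
  have hX0 := subspaceGap_nonneg X₁ X₂
  have hY0 := subspaceGap_nonneg (projectedSubspace M X₁) (projectedSubspace M X₂)
  change Module.finrank ℝ (projectedSubspace M X₁) = _ at hdim
  change subspaceGap (projectedSubspace M X₁) (projectedSubspace M X₂) ≤ _ at hle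
  change _ ≤ _ * subspaceGap (projectedSubspace M X₁) (projectedSubspace M X₂) at hge
  rw [hdim] at hY
  rw [affinityEstimateSq, hX]
  set D := subspaceGap X₁ X₂
  set D' := subspaceGap (projectedSubspace M X₁) (projectedSubspace M X₂)
  have hpos : 0 < 1 - δ := by linarith
  rw [← div_eq_mul_inv, div_mul_eq_mul_div, le_div_iff₀ hpos] at hle
  rw [inv_mul_eq_div, div_mul_eq_mul_div, le_div_iff₀ hpos] at hge
  have hd0 : 0 ≤ (Module.finrank ℝ X₂ : ℝ) / n := by positivity
  -- `(1 + δ)/(1 - δ) - 1 = 2δ/(1 - δ) ≤ 4δ` since `δ ≤ 1/2`.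
  have h2 : D' - D ≤ 4 * δ * D := by
    have : 0 ≤ δ * D * (1 - 2 * δ) := by
      apply mul_nonneg (by positivity); linarith
    refine le_of_mul_le_mul_right ?_ hpos
    nlinarith
  have h3 : D - D' ≤ 4 * δ * D := by
    refine le_of_mul_le_mul_left ?_ (show 0 < 1 + δ by linarith)
    nlinarith [mul_nonneg h0 hX0, mul_nonneg h0 (mul_nonneg h0 hX0)]
  have h4 : (Module.finrank ℝ X₂ : ℝ) / n * D ≤ ρ * D := by gcongr
  have h5 : 0 ≤ (Module.finrank ℝ X₂ : ℝ) / n * D := by positivity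
  rw [abs_le]
  constructor <;> nlinarith

theorem mainTheorem2 (ε : ℝ) (hε : 0 < ε) :
    ∃ c₁ c₂ : ℝ, 0 < c₁ ∧ 0 < c₂ ∧
      ∀ (N n : ℕ) (X₁ X₂ : Submodule ℝ (EuclideanSpace ℝ (Fin N))),
        Module.finrank ℝ X₁ ≤ Module.finrank ℝ X₂ → n < N →
        c₁ * (Module.finrank ℝ X₂ : ℝ) < (n : ℝ) →
        ∀ (Ω : Type*) [MeasurableSpace Ω] (P : Measure Ω) [IsProbabilityMeasure P]
          (Φ : Ω → Matrix (Fin n) (Fin N) ℝ), IsGaussianRandomMatrix Φ P →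
          (1 - Real.exp (-(c₂ * (n : ℝ))) ≤
            P.real {ω | |affinity (projectedSubspace (Φ ω) X₁) (projectedSubspace (Φ ω) X₂) ^ 2
                - affinityEstimateSq n X₁ X₂|
              ≤ ((Module.finrank ℝ X₁ : ℝ) - affinity X₁ X₂ ^ 2) * ε}) ∧
          (¬ X₁ ≤ X₂ →
            1 - Real.exp (-(c₂ * (n : ℝ))) ≤
              P.real {ω | |affinity (projectedSubspace (Φ ω) X₁) (projectedSubspace (Φ ω) X₂) ^ 2
                  - affinityEstimateSq n X₁ X₂|
                < ((Module.finrank ℝ X₁ : ℝ) - affinity X₁ X₂ ^ 2) * ε}) := by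
  obtain ⟨e, he0, he1, heε⟩ : ∃ e : ℝ, 0 < e ∧ e ≤ 1 ∧ e ≤ ε :=
    ⟨min ε 1, lt_min hε one_pos, min_le_right _ _, min_le_left _ _⟩
  -- With `η = e/64`, `δ = 4η = e/16` and `ρ = e/4`, the total `4δ + ρ = e/2` is strictly below `ε`,
  -- leaving room for the strict inequality.
  refine ⟨max (16 / ((e / 64) ^ 2 / 8)) (4 / e), (e / 64) ^ 2 / 16, by positivity,
    by positivity, ?_⟩
  intro N n X₁ X₂ hd _ hn Ω _ P _ Φ hΦ
  have hn0 : (0 : ℝ) < n := lt_of_le_of_lt (by positivity) hn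
  have hc1 : 16 / ((e / 64) ^ 2 / 8) * (Module.finrank ℝ X₂ : ℝ) ≤ n :=
    (mul_le_mul_of_nonneg_right (le_max_left _ _) (Nat.cast_nonneg _)).trans hn.le
  have hc2 : 4 / e * (Module.finrank ℝ X₂ : ℝ) ≤ n :=
    (mul_le_mul_of_nonneg_right (le_max_right _ _) (Nat.cast_nonneg _)).trans hn.le
  have hρ : (Module.finrank ℝ X₂ : ℝ) / n ≤ e / 4 := by
    rw [div_mul_eq_mul_div, div_le_iff₀ he0] at hc2
    rw [div_le_iff₀ hn0]
    linarith
  have hgap : 0 ≤ (Module.finrank ℝ X₁ : ℝ) - affinity X₁ X₂ ^ 2 := by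
    rw [finrank_sub_affinity_sq]
    exact subspaceGap_nonneg _ _
  have hbad := hΦ.measure_not_nearIsometry_sup_le (by exact_mod_cast hn0) hd
    (η := e / 64) (by positivity) (by linarith) hc1
  -- Only subadditivity is used, so `S` need not be measurable.
  have hgood : ∀ S : Set Ω, (∀ ω, (∀ x ∈ X₁ ⊔ X₂,
      |‖Matrix.toEuclideanLin (Φ ω) x‖ ^ 2 - ‖x‖ ^ 2| ≤ 4 * (e / 64) * ‖x‖ ^ 2) → ω ∈ S) →
      1 - Real.exp (-((e / 64) ^ 2 / 16 * n)) ≤ P.real S := by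
    intro S hS
    have hcover : (1 : ℝ) ≤ P.real S + P.real {ω | ¬ ∀ x ∈ X₁ ⊔ X₂,
        |‖Matrix.toEuclideanLin (Φ ω) x‖ ^ 2 - ‖x‖ ^ 2| ≤ 4 * (e / 64) * ‖x‖ ^ 2} := by
      rw [← probReal_univ (μ := P)]
      refine (measureReal_mono fun ω _ => ?_).trans (measureReal_union_le _ _)
      by_cases h : ω ∈ S
      · exact Or.inl h
      · exact Or.inr fun h' => h (hS ω h')
    linarith
  refine ⟨hgood _ fun ω hω => ?_, fun hX => hgood _ fun ω hω => ?_⟩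
  · refine (abs_affinity_sq_sub_estimate_le (by positivity) (by linarith) hρ hω).trans ?_
    gcongr
    linarith
  · refine (abs_affinity_sq_sub_estimate_le (by positivity) (by linarith) hρ hω).trans_lt ?_
    have hpos : 0 < (Module.finrank ℝ X₁ : ℝ) - affinity X₁ X₂ ^ 2 := by
      refine hgap.lt_of_ne fun h => hX (le_of_subspaceGap_eq_zero ?_)
      rw [← finrank_sub_affinity_sq, ← h]
    gcongr
    linarith
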